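/- Let $p\in[1,2]$, $\alpha>2$, $\beta>0$, and let $J:\mathbb N\to\mathbb R$ satisfy $J(k)=O(k^{-\alpha})$ as $k\to\infty$ (in particular, $J(k)\sim k^{-\alpha}$ is allowed; $J$ may take either sign). For height configurations $\phi\in\mathbb Z^{\mathbb Z}$ consider the formal Hamiltonian $H(\phi)=\sum_{i\ne j\in\mathbb Z}J(|i-j|)\,|\phi_i-\phi_j|^p$. For a finite $\Lambda\subset\mathbb Z$ and $\omega\in\mathbb Z^{\mathbb Z}$ let $\mu_\Lambda^\omega$ be the probability measure on $\{\phi:\phi_i=\omega_i\ \forall i\notin\Lambda\}$ with $$\mu_\Lambda^\omega(\phi)\propto\exp\bigl(-\beta(H(\phi)-H(\omega))\bigr),\qquad H(\phi)-H(\omega):=\sum_{i\neq j}J(|i-j|)\bigl(|\phi_i-\phi_j|^p-|\omega_i-\omega_j|^p\bigr),$$ which is defined when these sums converge absolutely and the partition function is finite; $\mu^0_\Lambda$ is the case $\omega\equiv0$. A Gibbs measure is a probability measure $\mu$ on $\mathbb Z^{\mathbb Z}$ such that, for every finite $\Lambda\subset\mathbb Z$, $\mu_\Lambda^\omega$ is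 defined for $\mu$-almost every $\omega$ and $\mu=\int\mu_\Lambda^\omega\,d\mu(\omega)$. It is shift-invariant if it is invariant under all translations of $\mathbb Z$. Then there is no increasing sequence $(\Lambda_n)_n$ of finite subsets of $\mathbb Z$ with $\bigcup_n\Lambda_n=\mathbb Z$ (in particular, no such sequence of boxes, i.e. finite intervals) for which the measures $\mu^0_{\Lambda_n}$ are defined and the following two properties hold together: 1. there is a finite constant $C$ with $\langle\phi_0^2\rangle_{\mu^0_{\Lambda_n}}<C$ for every $n$; 2. $(\mu^0_{\Lambda_n})_n$ converges weakly (for the product topology on $\mathbb Z^{\mathbb Z}$) to a shift-invariant Gibbs measure. -/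

import Mathlib

open MeasureTheory Filter Topology Asymptotics

noncomputable section

namespace LongRangeSOS

/-- Height configurations `φ : ℤ → ℤ`, with the product topology and product σ-algebra. -/
abbrev Config : Type := ℤ → ℤ

/-- The potential `V(x) = |x|^p`. -/
def V (p : ℝ) (x : ℤ) : ℝ := |(x : ℝ)| ^ p

/-- The `(i, j)` term of the formal difference `H(φ) - H(ω)`, where
`H(φ) = ∑_{i ≠ j} J(|i - j|) V(φ_i - φ_j)` (sum over ordered pairs).
It vanishes when `i = j`. -/
def energyTerm (p : ℝ) (J : ℕ → ℝ) (φ ω : Config) (q : ℤ × ℤ) : ℝ :=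
  J (q.1 - q.2).natAbs * (V p (φ q.1 - φ q.2) - V p (ω q.1 - ω q.2))

/-- `H(φ) - H(ω)`. If `φ = ω` off a finite set `Λ`, only pairs that meet `Λ` contribute.
For `ω = 0` and `p ≠ 0` this is `H(φ)` itself. -/
def energyDiff (p : ℝ) (J : ℕ → ℝ) (φ ω : Config) : ℝ :=
  ∑' q : ℤ × ℤ, energyTerm p J φ ω q

/-- The configuration equal to `ψ` in `Λ` and to `ω` outside `Λ`. -/
def glue (Λ : Finset ℤ) (ψ : Λ → ℤ) (ω : Config) : Config :=
  fun i => if h : i ∈ Λ then ψ ⟨i, h⟩ else ω i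

/-- The unnormalised finite-volume measure: every `φ` that agrees with `ω` off `Λ` gets mass
`exp (-β (H(φ) - H(ω)))`. -/
def boltzmann (β p : ℝ) (J : ℕ → ℝ) (Λ : Finset ℤ) (ω : Config) : Measure Config :=
  Measure.sum fun ψ : Λ → ℤ =>
    ENNReal.ofReal (Real.exp (-β * energyDiff p J (glue Λ ψ ω) ω)) • Measure.dirac (glue Λ ψ ω)

/-- The finite-volume measure `μ_Λ^ω`, i.e. `boltzmann` divided by its total mass (the partition
function). It is the zero measure, hence not a probability measure, if the partition function is
infinite. -/
def finiteVolume (β p : ℝ) (J : ℕ → ℝ) (Λ : Finset ℤ) (ω : Config) : Measure Config :=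
  (boltzmann β p J Λ ω Set.univ)⁻¹ • boltzmann β p J Λ ω

/-- Gibbs measures: probability measures that satisfy the DLR equations
`μ = ∫ μ_Λ^ω dμ(ω)` for all finite `Λ`. The field `summable` says that the energy differences
which define `μ_Λ^ω` are convergent sums for `μ`-almost every boundary condition `ω`. -/
structure IsGibbs (β p : ℝ) (J : ℕ → ℝ) (μ : Measure Config) : Prop where
  isProbabilityMeasure : IsProbabilityMeasure μ
  summable : ∀ Λ : Finset ℤ, ∀ᵐ ω ∂μ, ∀ φ : Config, (∀ i, i ∉ Λ → φ i = ω i) →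
    Summable (energyTerm p J φ ω)
  dlr : ∀ (Λ : Finset ℤ) (A : Set Config), MeasurableSet A →
    μ A = ∫⁻ ω, finiteVolume β p J Λ ω A ∂μ

/-- Translation of a configuration by `v`. -/
def shift (v : ℤ) (φ : Config) : Config := fun i => φ (i + v)

/-- Invariance of a measure under all translations of `ℤ`. -/
def IsShiftInvariant (μ : Measure Config) : Prop :=
  ∀ v : ℤ, μ.map (shift v) = μ

end LongRangeSOS

end

/-!
Raising all heights in `Λ = {0, …, N - 1}` by one changes the energy only through pairs `(i, j)`
with exactly one site in `Λ`. Under a shift-invariant measure with finite second moments such a pair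
costs at most `|J(|i - j|)|` times a constant in expectation, and at most `2 |d|` pairs have
difference `d`, so the expected cost is bounded by a multiple of `∑_d |d| |J(|d|)|`, uniformly
in `N`. The DLR equations turn this into contiguity: a sequence of events whose images under the
raising maps have probability tending to zero must itself have probability tending to zero. On the
other hand raising `Λ` moves the difference of the mean heights over `{0, …, N - 1}` and
`{0, …, N² - 1}` by `1 - 1 / N`, whereas by the mean ergodic theorem this difference tends to zero
in probability.
-/

section General

open scoped ENNReal

variable {X : Type*} [MeasurableSpace X]

lemma birkhoffAverage_compMeasurePreserving_toLp_ae_eq {E : Type*} [NormedAddCommGroup E]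
    [NormedSpace ℝ E] {q : ℝ≥0∞} {μ : Measure X} {T : X → X} (hT : MeasurePreserving T μ μ)
    {f : X → E} (hf : MemLp f q μ) (N : ℕ) :
    (birkhoffAverage ℝ (Lp.compMeasurePreserving T hT) id N (hf.toLp f) : Lp E q μ) =ᵐ[μ]
      birkhoffAverage ℝ T f N := by
  have hiter (k : ℕ) : (Lp.compMeasurePreserving T hT)^[k] (hf.toLp f) =ᵐ[μ] f ∘ T^[k] := by
    rw [Lp.compMeasurePreserving_iterate, Lp.toLp_compMeasurePreserving]
    exact MemLp.coeFn_toLp _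
  simp only [birkhoffAverage, birkhoffSum]
  filter_upwards [Lp.coeFn_smul (N : ℝ)⁻¹
      (∑ k ∈ Finset.range N, id ((Lp.compMeasurePreserving T hT)^[k] (hf.toLp f))),
    Lp.coeFn_finsetSum (Finset.range N)
      fun k => id ((Lp.compMeasurePreserving T hT)^[k] (hf.toLp f)),
    ae_all_iff.2 hiter] with x hsmul hsum hiter
  rw [hsmul, Pi.smul_apply, hsum, Finset.sum_apply]
  exact congrArg _ (Finset.sum_congr rfl fun k _ => hiter k)

lemma tendstoInMeasure_birkhoffAverage_sub_birkhoffAverage {E : Type*} [NormedAddCommGroup E]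
    [InnerProductSpace ℝ E] [CompleteSpace E] {μ : Measure X} {T : X → X}
    (hT : MeasurePreserving T μ μ) {f : X → E} (hf : MemLp f 2 μ) {ι : Type*} {l : Filter ι}
    {m n : ι → ℕ} (hm : Tendsto m l atTop) (hn : Tendsto n l atTop) :
    TendstoInMeasure μ (fun i => birkhoffAverage ℝ T f (m i) - birkhoffAverage ℝ T f (n i))
      l 0 := by
  let U : Lp E 2 μ →ₗᵢ[ℝ] Lp E 2 μ := Lp.compMeasurePreservingₗᵢ ℝ T hT
  have hlim := U.toContinuousLinearMap.tendsto_birkhoffAverage_orthogonalProjection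
    U.norm_toContinuousLinearMap_le (hf.toLp f)
  have hsub := tendstoInMeasure_of_tendsto_Lp (((hlim.comp hm).sub (hlim.comp hn)).trans_eq
    (by rw [sub_self]))
  refine hsub.congr (fun i => ?_) (Lp.coeFn_zero E 2 μ)
  exact (Lp.coeFn_sub _ _).trans
    ((birkhoffAverage_compMeasurePreserving_toLp_ae_eq hT hf (m i)).sub
      (birkhoffAverage_compMeasurePreserving_toLp_ae_eq hT hf (n i)))

lemma lintegral_ofReal_le_of_tendsto [TopologicalSpace X] [OpensMeasurableSpace X]
    [HasOuterApproxClosed X] {ν : ℕ → ProbabilityMeasure X} {μ : ProbabilityMeasure X}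
    (hν : Tendsto ν atTop (𝓝 μ)) {f : X → ℝ} (hf : Continuous f) (hf₀ : 0 ≤ f) {C : ℝ≥0∞}
    (hC : ∀ n, ∫⁻ x, ENNReal.ofReal (f x) ∂(ν n : Measure X) ≤ C) :
    ∫⁻ x, ENNReal.ofReal (f x) ∂(μ : Measure X) ≤ C :=
  (lintegral_le_liminf_lintegral_of_forall_isOpen_measure_le_liminf_measure hf hf₀ fun _ hG =>
    ProbabilityMeasure.le_liminf_measure_open_of_tendsto hν hG).trans
      (liminf_le_of_frequently_le' (Frequently.of_forall hC))

lemma summable_natCast_mul_of_isBigO_rpow {α : ℝ} (hα : 2 < α) {J : ℕ → ℝ}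
    (hJ : J =O[atTop] fun k : ℕ => (k : ℝ) ^ (-α)) : Summable fun k : ℕ => (k : ℝ) * J k := by
  refine summable_of_isBigO_nat (Real.summable_nat_rpow.2 (show 1 + -α < -1 by linarith)) ?_
  refine ((isBigO_refl (fun k : ℕ => (k : ℝ)) atTop).mul hJ).congr' .rfl ?_
  filter_upwards [eventually_gt_atTop 0] with k hk
  rw [Real.rpow_add (by exact_mod_cast hk), Real.rpow_one]

end General

namespace LongRangeSOS

open scoped ENNReal NNReal

section Energy

variable {β p : ℝ} {J : ℕ → ℝ}

/-- The sum of the absolute values of the terms of `H(φ) - H(ω)`, which bounds `|H(φ) - H(ω)|` and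
is finite exactly when that sum converges absolutely. -/
noncomputable def energyCost (p : ℝ) (J : ℕ → ℝ) (φ ω : Config) : ℝ≥0∞ :=
  ∑' q : ℤ × ℤ, ‖energyTerm p J φ ω q‖ₑ

lemma enorm_energyDiff_le_energyCost (φ ω : Config) :
    ‖energyDiff p J φ ω‖ₑ ≤ energyCost p J φ ω :=
  enorm_tsum_le_tsum_enorm

lemma energyDiff_sub_energyDiff {χ φ ω : Config} (hχ : Summable (energyTerm p J χ ω))
    (hφ : Summable (energyTerm p J φ ω)) :
    energyDiff p J χ ω - energyDiff p J φ ω = energyDiff p J χ φ := by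
  rw [energyDiff, energyDiff, ← hχ.tsum_sub hφ]
  exact tsum_congr fun q => by simp only [energyTerm]; ring

lemma exp_neg_mul_energyDiff_le {χ φ ω : Config} (hχ : Summable (energyTerm p J χ ω))
    (hφ : Summable (energyTerm p J φ ω)) {M : ℝ≥0} (hM : energyCost p J χ φ ≤ M) :
    Real.exp (-β * energyDiff p J φ ω) ≤
      Real.exp (|β| * M) * Real.exp (-β * energyDiff p J χ ω) := by
  have hdiff : |energyDiff p J χ φ| ≤ M := by
    have h := (enorm_energyDiff_le_energyCost χ φ).trans hM
    rwa [enorm_eq_nnnorm, ENNReal.coe_le_coe, ← NNReal.coe_le_coe, coe_nnnorm,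
      Real.norm_eq_abs] at h
  rw [← Real.exp_add, Real.exp_le_exp]
  have hβ : β * energyDiff p J χ φ ≤ |β| * M :=
    (le_abs_self _).trans (abs_mul β _ ▸ mul_le_mul_of_nonneg_left hdiff (abs_nonneg β))
  rw [← energyDiff_sub_energyDiff hχ hφ] at hβ
  linarith

lemma measurable_energyTerm {f g : Config → Config} (hf : Measurable f) (hg : Measurable g)
    (q : ℤ × ℤ) : Measurable fun φ => energyTerm p J (f φ) (g φ) q := by
  have hV {h : Config → Config} (hh : Measurable h) :
      Measurable fun φ => V p (h φ q.1 - h φ q.2) :=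
    (Measurable.of_discrete (f := V p)).comp (by fun_prop)
  exact ((hV hf).sub (hV hg)).const_mul _

lemma measurable_energyCost {f g : Config → Config} (hf : Measurable f) (hg : Measurable g) :
    Measurable fun φ => energyCost p J (f φ) (g φ) :=
  Measurable.tsum fun q => (measurable_energyTerm hf hg q).enorm

end Energy

section Raise

variable {β p : ℝ} {J : ℕ → ℝ}

/-- The configuration obtained from `φ` by adding `c` to all heights in `Λ`. -/
def raise (Λ : Finset ℤ) (c : ℤ) (φ : Config) : Config :=
  fun i => if i ∈ Λ then φ i + c else φ i

lemma measurable_raise (Λ : Finset ℤ) (c : ℤ) : Measurable (raise Λ c) := by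
  refine measurable_pi_lambda _ fun i => ?_
  unfold raise
  split_ifs <;> fun_prop

lemma raise_glue (Λ : Finset ℤ) (c : ℤ) (ψ : Λ → ℤ) (ω : Config) :
    raise Λ c (glue Λ ψ ω) = glue Λ (fun i => ψ i + c) ω := by
  funext i
  by_cases h : i ∈ Λ <;> simp [raise, glue, h]

lemma raise_neg_raise (Λ : Finset ℤ) (c : ℤ) (φ : Config) : raise Λ (-c) (raise Λ c φ) = φ := by
  funext i
  by_cases h : i ∈ Λ <;> simp [raise, h]

lemma measurable_energyCost_raise (Λ : Finset ℤ) (c : ℤ) :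
    Measurable fun φ => energyCost p J (raise Λ c φ) φ :=
  measurable_energyCost (measurable_raise Λ c) measurable_id

lemma measurableSet_energyCost_raise_le (Λ : Finset ℤ) (c : ℤ) (M : ℝ≥0∞) :
    MeasurableSet {φ | energyCost p J (raise Λ c φ) φ ≤ M} :=
  measurableSet_le (measurable_energyCost_raise Λ c) measurable_const

lemma boltzmann_apply (Λ : Finset ℤ) (ω : Config) {A : Set Config} (hA : MeasurableSet A) :
    boltzmann β p J Λ ω A = ∑' ψ : Λ → ℤ, A.indicator
      (fun φ => ENNReal.ofReal (Real.exp (-β * energyDiff p J φ ω))) (glue Λ ψ ω) := by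
  rw [boltzmann, Measure.sum_apply _ hA]
  refine tsum_congr fun ψ => ?_
  rw [Measure.smul_apply, Measure.dirac_apply' _ hA]
  by_cases h : glue Λ ψ ω ∈ A <;> simp [h]

lemma boltzmann_raise_preimage (Λ : Finset ℤ) (c : ℤ) (ω : Config) {A : Set Config}
    (hA : MeasurableSet A) :
    boltzmann β p J Λ ω (raise Λ (-c) ⁻¹' A) = ∑' ψ : Λ → ℤ, A.indicator
      (fun φ => ENNReal.ofReal (Real.exp (-β * energyDiff p J (raise Λ c φ) ω))) (glue Λ ψ ω) := by
  rw [boltzmann_apply Λ ω (measurable_raise Λ (-c) hA),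
    ← (Equiv.addRight fun _ : Λ => c).tsum_eq]
  refine tsum_congr fun ψ => ?_
  have hψ : glue Λ (Equiv.addRight (fun _ : Λ => c) ψ) ω = raise Λ c (glue Λ ψ ω) :=
    (raise_glue Λ c ψ ω).symm
  rw [hψ]
  by_cases h : glue Λ ψ ω ∈ A <;> simp [h, raise_neg_raise]

lemma boltzmann_inter_le_raise_preimage {Λ : Finset ℤ} {ω : Config}
    (hω : ∀ φ : Config, (∀ i, i ∉ Λ → φ i = ω i) → Summable (energyTerm p J φ ω))
    (c : ℤ) {A : Set Config} (hA : MeasurableSet A) (M : ℝ≥0) :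
    boltzmann β p J Λ ω (A ∩ {φ | energyCost p J (raise Λ c φ) φ ≤ M}) ≤
      ENNReal.ofReal (Real.exp (|β| * M)) * boltzmann β p J Λ ω (raise Λ (-c) ⁻¹' A) := by
  rw [boltzmann_apply Λ ω (hA.inter (measurableSet_energyCost_raise_le Λ c M)),
    boltzmann_raise_preimage Λ c ω hA, ← ENNReal.tsum_mul_left]
  refine ENNReal.tsum_le_tsum fun ψ => ?_
  by_cases h : glue Λ ψ ω ∈ A ∩ {φ | energyCost p J (raise Λ c φ) φ ≤ M}
  · have hφ := hω (glue Λ ψ ω) fun i hi => by simp [glue, hi]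
    have hχ := hω (raise Λ c (glue Λ ψ ω)) fun i hi => by simp [raise, glue, hi]
    rw [Set.indicator_of_mem h, Set.indicator_of_mem h.1, ← ENNReal.ofReal_mul (Real.exp_pos _).le]
    exact ENNReal.ofReal_le_ofReal (exp_neg_mul_energyDiff_le hχ hφ h.2)
  · rw [Set.indicator_of_notMem h]
    exact zero_le

end Raise

section Contiguity

variable {β p : ℝ} {J : ℕ → ℝ} {μ : Measure Config}

lemma IsGibbs.measure_inter_le_raise_preimage (hμ : IsGibbs β p J μ) (Λ : Finset ℤ) (c : ℤ)
    {A : Set Config} (hA : MeasurableSet A) (M : ℝ≥0) :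
    μ (A ∩ {φ | energyCost p J (raise Λ c φ) φ ≤ M}) ≤
      ENNReal.ofReal (Real.exp (|β| * M)) * μ (raise Λ (-c) ⁻¹' A) := by
  rw [hμ.dlr Λ _ (hA.inter (measurableSet_energyCost_raise_le Λ c M)),
    hμ.dlr Λ _ (measurable_raise Λ (-c) hA), ← lintegral_const_mul' _ _ ENNReal.ofReal_ne_top]
  refine lintegral_mono_ae ?_
  filter_upwards [hμ.summable Λ] with ω hω
  simp only [finiteVolume, Measure.smul_apply, smul_eq_mul]
  rw [mul_left_comm]
  gcongr
  exact boltzmann_inter_le_raise_preimage hω c hA M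

lemma IsGibbs.measure_le_raise_preimage_add (hμ : IsGibbs β p J μ) (Λ : Finset ℤ) (c : ℤ)
    {A : Set Config} (hA : MeasurableSet A) {M : ℝ≥0} (hM : M ≠ 0) :
    μ A ≤ ENNReal.ofReal (Real.exp (|β| * M)) * μ (raise Λ (-c) ⁻¹' A) +
      (∫⁻ φ, energyCost p J (raise Λ c φ) φ ∂μ) / M := by
  have hcover : A ⊆ (A ∩ {φ | energyCost p J (raise Λ c φ) φ ≤ M}) ∪
      {φ | M ≤ energyCost p J (raise Λ c φ) φ} := fun φ hφ =>
    (le_total (energyCost p J (raise Λ c φ) φ) M).imp (⟨hφ, ·⟩) id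
  refine (measure_mono hcover).trans ((measure_union_le _ _).trans (add_le_add ?_ ?_))
  · exact hμ.measure_inter_le_raise_preimage Λ c hA M
  · exact meas_ge_le_lintegral_div (measurable_energyCost_raise Λ c).aemeasurable
      (ENNReal.coe_ne_zero.2 hM) ENNReal.coe_ne_top

lemma IsGibbs.tendsto_measure_of_tendsto_raise_preimage (hμ : IsGibbs β p J μ) {ι : Type*}
    {l : Filter ι} {Λ : ι → Finset ℤ} {c : ℤ} {A : ι → Set Config}
    (hA : ∀ i, MeasurableSet (A i)) {K : ℝ≥0∞} (hK : K ≠ ⊤)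
    (hcost : ∀ i, ∫⁻ φ, energyCost p J (raise (Λ i) c φ) φ ∂μ ≤ K)
    (hlim : Tendsto (fun i => μ (raise (Λ i) (-c) ⁻¹' A i)) l (𝓝 0)) :
    Tendsto (fun i => μ (A i)) l (𝓝 0) := by
  refine ENNReal.tendsto_nhds_zero.2 fun ε hε => ?_
  have hε₂ : ε / 2 ≠ 0 := (ENNReal.half_pos hε.ne').ne'
  obtain ⟨M, hM₀, hM⟩ : ∃ M : ℝ≥0, M ≠ 0 ∧ K / M ≤ ε / 2 := by
    obtain ⟨n, hn₀, hn⟩ := ENNReal.exists_nat_pos_mul_gt hε₂ hK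
    refine ⟨n, Nat.cast_ne_zero.2 hn₀.ne', ENNReal.div_le_of_le_mul ?_⟩
    rw [ENNReal.coe_natCast, mul_comm]
    exact hn.le
  have hmul := ENNReal.Tendsto.const_mul (a := ENNReal.ofReal (Real.exp (|β| * M))) hlim
    (Or.inr ENNReal.ofReal_ne_top)
  rw [mul_zero] at hmul
  filter_upwards [hmul.eventually_le_const hε₂.bot_lt] with i hi
  calc μ (A i)
      ≤ ENNReal.ofReal (Real.exp (|β| * M)) * μ (raise (Λ i) (-c) ⁻¹' A i) +
        (∫⁻ φ, energyCost p J (raise (Λ i) c φ) φ ∂μ) / M :=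
        hμ.measure_le_raise_preimage_add (Λ i) c (hA i) hM₀
    _ ≤ ε / 2 + ε / 2 := add_le_add hi ((ENNReal.div_le_div_right (hcost i) _).trans hM)
    _ = ε := ENNReal.add_halves ε

end Contiguity

section ExpectedCost

variable {p : ℝ} {J : ℕ → ℝ}

lemma V_nonneg (p : ℝ) (x : ℤ) : 0 ≤ V p x :=
  Real.rpow_nonneg (abs_nonneg _) p

lemma V_le_sq (hp₀ : 0 < p) (hp₂ : p ≤ 2) (x : ℤ) : V p x ≤ (x : ℝ) ^ 2 := by
  rcases eq_or_ne x 0 with rfl | hx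
  · simp [V, Real.zero_rpow hp₀.ne']
  · rw [V, ← sq_abs, ← Real.rpow_two]
    exact Real.rpow_le_rpow_of_exponent_le (by exact_mod_cast Int.one_le_abs hx) hp₂

lemma abs_V_sub_V_le (hp₀ : 0 < p) (hp₂ : p ≤ 2) (x y : ℤ) :
    |V p x - V p y| ≤ 2 * ((x - y : ℤ) : ℝ) ^ 2 + 2 * (y : ℝ) ^ 2 := by
  refine abs_sub_le_of_nonneg_of_le (V_nonneg p x) ((V_le_sq hp₀ hp₂ x).trans ?_)
    (V_nonneg p y) ((V_le_sq hp₀ hp₂ y).trans ?_)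
  · push_cast
    linarith [sq_nonneg ((x : ℝ) - 2 * y)]
  · nlinarith [sq_nonneg ((x - y : ℤ) : ℝ), sq_nonneg (y : ℝ)]

/-- The total absolute coupling between `Λ` and its complement, over ordered pairs of sites. -/
noncomputable def boundaryCoupling (J : ℕ → ℝ) (Λ : Finset ℤ) : ℝ≥0∞ :=
  ∑' q : ℤ × ℤ, if (q.1 ∈ Λ ↔ q.2 ∈ Λ) then 0 else ‖J (q.1 - q.2).natAbs‖ₑ

lemma enorm_energyTerm_raise_le (hp₀ : 0 < p) (hp₂ : p ≤ 2) (Λ : Finset ℤ) (c : ℤ) (φ : Config)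
    (q : ℤ × ℤ) :
    ‖energyTerm p J (raise Λ c φ) φ q‖ₑ ≤
      (if (q.1 ∈ Λ ↔ q.2 ∈ Λ) then 0 else ‖J (q.1 - q.2).natAbs‖ₑ) *
        ENNReal.ofReal (2 * (c : ℝ) ^ 2 + (4 * (φ q.1 : ℝ) ^ 2 + 4 * (φ q.2 : ℝ) ^ 2)) := by
  split_ifs with h
  · have hdiff : raise Λ c φ q.1 - raise Λ c φ q.2 = φ q.1 - φ q.2 := by
      by_cases hi : q.1 ∈ Λ <;> simp [raise, hi, ← h]
    simp [energyTerm, hdiff]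
  · have hdiff : ((raise Λ c φ q.1 - raise Λ c φ q.2 - (φ q.1 - φ q.2) : ℤ) : ℝ) ^ 2 = c ^ 2 := by
      by_cases hi : q.1 ∈ Λ <;> by_cases hj : q.2 ∈ Λ <;> simp [raise, hi, hj] at h ⊢
    have hV := abs_V_sub_V_le hp₀ hp₂ (raise Λ c φ q.1 - raise Λ c φ q.2) (φ q.1 - φ q.2)
    rw [hdiff] at hV
    rw [energyTerm, enorm_mul, Real.enorm_eq_ofReal_abs (_ - _)]
    gcongr
    refine hV.trans ?_
    push_cast
    linarith [sq_nonneg ((φ q.1 : ℝ) + φ q.2)]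

lemma measurable_height (i : ℤ) : Measurable fun φ : Config => (φ i : ℝ) :=
  Measurable.of_discrete.comp (measurable_pi_apply i)

lemma lintegral_ofReal_add_sq_height_add_sq_height_le {μ : Measure Config}
    [IsProbabilityMeasure μ] {s : ℝ≥0∞}
    (hs : ∀ i : ℤ, ∫⁻ φ, ENNReal.ofReal ((φ i : ℝ) ^ 2) ∂μ ≤ s) {a : ℝ} (ha : 0 ≤ a) (i j : ℤ) :
    ∫⁻ φ, ENNReal.ofReal (a + (4 * (φ i : ℝ) ^ 2 + 4 * (φ j : ℝ) ^ 2)) ∂μ ≤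
      ENNReal.ofReal a + (4 * s + 4 * s) := by
  have hmeas (i : ℤ) : Measurable fun φ : Config => ENNReal.ofReal (4 * (φ i : ℝ) ^ 2) :=
    (((measurable_height i).pow_const 2).const_mul 4).ennreal_ofReal
  have hsite (i : ℤ) : ∫⁻ φ, ENNReal.ofReal (4 * (φ i : ℝ) ^ 2) ∂μ ≤ 4 * s := by
    simp_rw [ENNReal.ofReal_mul zero_le_four, ENNReal.ofReal_ofNat]
    rw [lintegral_const_mul' _ _ ENNReal.ofNat_ne_top]
    gcongr
    exact hs i
  have hsplit (φ : Config) : ENNReal.ofReal (a + (4 * (φ i : ℝ) ^ 2 + 4 * (φ j : ℝ) ^ 2)) =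
      ENNReal.ofReal a +
        (ENNReal.ofReal (4 * (φ i : ℝ) ^ 2) + ENNReal.ofReal (4 * (φ j : ℝ) ^ 2)) := by
    rw [ENNReal.ofReal_add ha (by positivity), ENNReal.ofReal_add (by positivity) (by positivity)]
  simp_rw [hsplit]
  rw [lintegral_add_left measurable_const, lintegral_add_left (hmeas i), lintegral_const,
    measure_univ, mul_one]
  gcongr <;> exact hsite _

lemma lintegral_energyCost_raise_le (hp₀ : 0 < p) (hp₂ : p ≤ 2) (Λ : Finset ℤ) (c : ℤ)
    {μ : Measure Config} [IsProbabilityMeasure μ] {s : ℝ≥0∞}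
    (hs : ∀ i : ℤ, ∫⁻ φ, ENNReal.ofReal ((φ i : ℝ) ^ 2) ∂μ ≤ s) :
    ∫⁻ φ, energyCost p J (raise Λ c φ) φ ∂μ ≤
      boundaryCoupling J Λ * (ENNReal.ofReal (2 * (c : ℝ) ^ 2) + (4 * s + 4 * s)) := by
  simp only [energyCost]
  rw [lintegral_tsum fun q => ((measurable_energyTerm (measurable_raise Λ c)
    measurable_id' q).enorm).aemeasurable, boundaryCoupling, ← ENNReal.tsum_mul_right]
  refine ENNReal.tsum_le_tsum fun q => ?_
  refine (lintegral_mono fun φ => enorm_energyTerm_raise_le hp₀ hp₂ Λ c φ q).trans ?_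
  rw [lintegral_const_mul' _ _ (by split_ifs <;> simp)]
  gcongr
  exact lintegral_ofReal_add_sq_height_add_sq_height_le hs (by positivity) q.1 q.2

lemma tsum_ite_mem_Ico_translate_le (a b d : ℤ) (x : ℝ≥0∞) :
    ∑' i : ℤ, (if (i ∈ Finset.Ico a b ↔ i - d ∈ Finset.Ico a b) then 0 else x) ≤
      2 * (d.natAbs * x) := by
  -- A site separated from its translate by `Ico a b` lies within `d` of one of the two endpoints.
  let S : Finset ℤ := Finset.Ico (min a (a + d)) (max a (a + d)) ∪
    Finset.Ico (min b (b + d)) (max b (b + d))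
  have hcard : S.card ≤ 2 * d.natAbs := by
    refine (Finset.card_union_le _ _).trans ?_
    rw [Int.card_Ico, Int.card_Ico]
    omega
  have hsupp : ∀ i ∉ S,
      (if (i ∈ Finset.Ico a b ↔ i - d ∈ Finset.Ico a b) then 0 else x) = 0 := by
    intro i hi
    rw [if_pos]
    simp only [S, Finset.mem_union, Finset.mem_Ico, not_or] at hi
    simp only [Finset.mem_Ico]
    omega
  calc ∑' i : ℤ, (if (i ∈ Finset.Ico a b ↔ i - d ∈ Finset.Ico a b) then 0 else x)
      = ∑ i ∈ S, (if (i ∈ Finset.Ico a b ↔ i - d ∈ Finset.Ico a b) then 0 else x) :=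
        tsum_eq_sum hsupp
    _ ≤ S.card • x := Finset.sum_le_card_nsmul _ _ _ fun i _ => by split_ifs <;> simp
    _ ≤ (2 * d.natAbs) • x := by gcongr
    _ = 2 * (d.natAbs * x) := by rw [nsmul_eq_mul]; push_cast; ring

lemma boundaryCoupling_Ico_le (J : ℕ → ℝ) (a b : ℤ) :
    boundaryCoupling J (Finset.Ico a b) ≤ 2 * ∑' d : ℤ, (d.natAbs * ‖J d.natAbs‖ₑ) := by
  calc boundaryCoupling J (Finset.Ico a b)
      = ∑' (d : ℤ) (i : ℤ), (if (i ∈ Finset.Ico a b ↔ i - d ∈ Finset.Ico a b) then 0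
        else ‖J d.natAbs‖ₑ) := by
        rw [boundaryCoupling, ENNReal.tsum_prod']
        refine (tsum_congr fun i => ?_).trans ENNReal.tsum_comm
        rw [← (Equiv.subLeft i).tsum_eq]
        simp only [Equiv.subLeft_apply, sub_sub_cancel]
    _ ≤ 2 * ∑' d : ℤ, (d.natAbs * ‖J d.natAbs‖ₑ) := by
        rw [← ENNReal.tsum_mul_left]
        exact ENNReal.tsum_le_tsum fun d => tsum_ite_mem_Ico_translate_le a b d _

lemma tsum_natAbs_mul_enorm_ne_top (hJ : Summable fun k : ℕ => (k : ℝ) * J k) :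
    ∑' d : ℤ, (d.natAbs * ‖J d.natAbs‖ₑ) ≠ ⊤ := by
  have hint : Summable fun d : ℤ => ‖(d.natAbs : ℝ) * J d.natAbs‖ :=
    .of_nat_of_neg (by simpa using hJ.norm) (by simpa using hJ.norm)
  have hterm (k : ℕ) : ‖(k : ℝ) * J k‖ₑ = k * ‖J k‖ₑ := by rw [enorm_mul, Real.enorm_natCast]
  simpa only [hterm] using tsum_enorm_ne_top_iff_summable_norm.2 hint

lemma exists_lintegral_energyCost_raise_Ico_le (hp₀ : 0 < p) (hp₂ : p ≤ 2)
    (hJ : Summable fun k : ℕ => (k : ℝ) * J k) (c : ℤ) {μ : Measure Config}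
    [IsProbabilityMeasure μ] {s : ℝ≥0∞} (hs_top : s ≠ ⊤)
    (hs : ∀ i : ℤ, ∫⁻ φ, ENNReal.ofReal ((φ i : ℝ) ^ 2) ∂μ ≤ s) :
    ∃ K ≠ (⊤ : ℝ≥0∞), ∀ a b : ℤ,
      ∫⁻ φ, energyCost p J (raise (Finset.Ico a b) c φ) φ ∂μ ≤ K := by
  refine ⟨(2 * ∑' d : ℤ, (d.natAbs * ‖J d.natAbs‖ₑ)) *
    (ENNReal.ofReal (2 * (c : ℝ) ^ 2) + (4 * s + 4 * s)), ?_, fun a b => ?_⟩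
  · have hJ_top := tsum_natAbs_mul_enorm_ne_top hJ
    finiteness
  · refine (lintegral_energyCost_raise_le hp₀ hp₂ _ c hs).trans ?_
    gcongr
    exact boundaryCoupling_Ico_le J a b

end ExpectedCost

section MeanHeight

/-- The mean height over the sites `0, …, N - 1`; for `N = 0` it is `0`. -/
noncomputable def meanHeight (N : ℕ) (φ : Config) : ℝ :=
  (∑ i ∈ Finset.range N, (φ i : ℝ)) / N

lemma measurable_meanHeight (N : ℕ) : Measurable (meanHeight N) :=
  (Finset.measurable_sum (Finset.range N) fun i _ => measurable_height (i : ℤ)).div_const _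

lemma birkhoffAverage_shift_height (N : ℕ) :
    birkhoffAverage ℝ (shift 1) (fun φ : Config => (φ 0 : ℝ)) N = meanHeight N := by
  have hiter (k : ℕ) (φ : Config) (i : ℤ) : (shift 1)^[k] φ i = φ (i + k) := by
    induction k generalizing i with
    | zero => simp
    | succ k ih =>
      rw [Function.iterate_succ_apply', shift, ih]
      congr 1
      push_cast
      ring
  funext φ
  simp [birkhoffAverage, birkhoffSum, meanHeight, hiter, div_eq_inv_mul]

lemma meanHeight_raise {N n : ℕ} (hNn : N ≤ n) (c : ℤ) (φ : Config) :
    meanHeight n (raise (Finset.Ico 0 N) c φ) = meanHeight n φ + c * (N / n) := by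
  have hheight (i : ℕ) :
      (raise (Finset.Ico 0 N) c φ i : ℝ) = φ i + if i < N then (c : ℝ) else 0 := by
    by_cases hi : i < N <;> simp [raise, hi]
  have hcount : ∑ i ∈ Finset.range n, (if i < N then (c : ℝ) else 0) = N * c := by
    have hfilter : (Finset.range n).filter (· < N) = Finset.range N := by
      ext i
      simp only [Finset.mem_filter, Finset.mem_range]
      omega
    rw [← Finset.sum_filter, hfilter, Finset.sum_const, Finset.card_range, nsmul_eq_mul]
  rw [meanHeight, Finset.sum_congr rfl fun i _ => hheight i, Finset.sum_add_distrib, hcount,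
    meanHeight]
  ring

variable {μ : Measure Config}

lemma IsShiftInvariant.measurePreserving (hμ : IsShiftInvariant μ) (v : ℤ) :
    MeasurePreserving (shift v) μ μ :=
  ⟨measurable_pi_lambda _ fun _ => measurable_pi_apply _, hμ v⟩

lemma IsShiftInvariant.lintegral_sq_height (hμ : IsShiftInvariant μ) (i : ℤ) :
    ∫⁻ φ, ENNReal.ofReal ((φ i : ℝ) ^ 2) ∂μ = ∫⁻ φ, ENNReal.ofReal ((φ 0 : ℝ) ^ 2) ∂μ := by
  rw [← (hμ.measurePreserving i).lintegral_comp
    ((measurable_height 0).pow_const 2).ennreal_ofReal]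
  simp only [shift, zero_add]

lemma memLp_height_two {i : ℤ} (h : ∫⁻ φ, ENNReal.ofReal ((φ i : ℝ) ^ 2) ∂μ ≠ ⊤) :
    MemLp (fun φ : Config => (φ i : ℝ)) 2 μ := by
  refine (memLp_two_iff_integrable_sq (measurable_height i).aestronglyMeasurable).2
    ⟨((measurable_height i).pow_const 2).aestronglyMeasurable, ?_⟩
  rw [hasFiniteIntegral_iff_ofReal (Eventually.of_forall fun φ => sq_nonneg _)]
  exact h.lt_top

lemma IsShiftInvariant.tendstoInMeasure_meanHeight_sub_meanHeight_sq (hμ : IsShiftInvariant μ)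
    (h : ∫⁻ φ, ENNReal.ofReal ((φ 0 : ℝ) ^ 2) ∂μ ≠ ⊤) :
    TendstoInMeasure μ (fun N => meanHeight N - meanHeight (N ^ 2)) atTop 0 := by
  have hcauchy := tendstoInMeasure_birkhoffAverage_sub_birkhoffAverage (hμ.measurePreserving 1)
    (memLp_height_two h) tendsto_id (tendsto_pow_atTop two_ne_zero)
  simpa only [birkhoffAverage_shift_height, id_eq] using hcauchy

/-- The configurations whose mean heights at scales `N` and `N²` are closer than `1 / 2`. -/
def concordant (N : ℕ) : Set Config :=
  {φ | |meanHeight N φ - meanHeight (N ^ 2) φ| < 1 / 2}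

lemma measurableSet_concordant (N : ℕ) : MeasurableSet (concordant N) :=
  measurableSet_lt ((measurable_meanHeight N).sub (measurable_meanHeight (N ^ 2))).abs
    measurable_const

lemma raise_preimage_concordant_subset {N : ℕ} (hN : 4 ≤ N) :
    raise (Finset.Ico 0 N) (-1) ⁻¹' concordant N ⊆
      {φ | 1 / 4 ≤ ‖(meanHeight N - meanHeight (N ^ 2)) φ - 0‖} := by
  intro φ hφ
  have hN₀ : (4 : ℝ) ≤ N := by exact_mod_cast hN
  have hself : (N : ℝ) / N = 1 := div_self (by positivity)
  have hsq : (N : ℝ) / (N ^ 2 : ℕ) ≤ 1 / 4 := by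
    push_cast
    rw [div_le_div_iff₀ (by positivity) (by positivity)]
    nlinarith
  simp only [concordant, Set.mem_preimage, Set.mem_ofPred_eq, meanHeight_raise le_rfl,
    meanHeight_raise (Nat.le_self_pow two_ne_zero N), hself, Int.cast_neg, Int.cast_one] at hφ
  rw [Set.mem_ofPred_eq, sub_zero, Pi.sub_apply, Real.norm_eq_abs]
  exact le_trans (by linarith [(abs_lt.1 hφ).1]) (le_abs_self _)

end MeanHeight

end LongRangeSOS

open LongRangeSOS in
theorem corollary2_general {β p : ℝ} (hp₀ : 0 < p) (hp₂ : p ≤ 2) {J : ℕ → ℝ}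
    (hJ : Summable fun k : ℕ => (k : ℝ) * J k) {μ : Measure Config} (hμ : IsGibbs β p J μ)
    (hinv : IsShiftInvariant μ) : ∫⁻ φ, ENNReal.ofReal ((φ 0 : ℝ) ^ 2) ∂μ = ⊤ := by
  by_contra hfin
  have := hμ.isProbabilityMeasure
  have hmean := tendstoInMeasure_iff_norm.1
    (hinv.tendstoInMeasure_meanHeight_sub_meanHeight_sq hfin)
  obtain ⟨K, hK, hcost⟩ := exists_lintegral_energyCost_raise_Ico_le hp₀ hp₂ hJ 1 hfin
    fun i => (hinv.lintegral_sq_height i).le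
  have hraise : Tendsto (fun N : ℕ => μ (raise (Finset.Ico 0 N) (-1) ⁻¹' concordant N)) atTop
      (𝓝 0) :=
    tendsto_of_tendsto_of_tendsto_of_le_of_le' tendsto_const_nhds (hmean (1 / 4) (by norm_num))
      (.of_forall fun _ => zero_le) ((eventually_ge_atTop 4).mono fun N hN =>
        measure_mono (raise_preimage_concordant_subset hN))
  have hconcordant := hμ.tendsto_measure_of_tendsto_raise_preimage measurableSet_concordant hK
    (fun N => hcost 0 N) hraise
  have hcompl : Tendsto (fun N => μ (concordant N)ᶜ) atTop (𝓝 0) := by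
    refine (hmean (1 / 2) (by norm_num)).congr fun N => congrArg μ ?_
    ext φ
    simp [concordant]
  have hsum := hconcordant.add hcompl
  simp only [prob_add_prob_compl (measurableSet_concordant _), add_zero,
    tendsto_const_nhds_iff, one_ne_zero] at hsum

theorem corollary2 (p : ℝ) (hp : 1 ≤ p ∧ p ≤ 2) (α : ℝ) (hα : 2 < α) (β : ℝ) (hβ : 0 < β)
    (J : ℕ → ℝ) (hJ : J =O[atTop] fun k : ℕ => (k : ℝ) ^ (-α)) :
    ¬ ∃ Λ : ℕ → Finset ℤ,
      Monotone Λ ∧ (∀ i : ℤ, ∃ n, i ∈ Λ n) ∧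
      (∃ C : ℝ, ∀ n, ∫⁻ φ, ENNReal.ofReal ((φ 0 : ℝ) ^ 2)
        ∂(LongRangeSOS.finiteVolume β p J (Λ n) 0) < ENNReal.ofReal C) ∧
      ∃ (hΛ : ∀ n, IsProbabilityMeasure (LongRangeSOS.finiteVolume β p J (Λ n) 0))
        (μ : ProbabilityMeasure LongRangeSOS.Config),
        Tendsto (β := ProbabilityMeasure LongRangeSOS.Config)
          (fun n => ⟨LongRangeSOS.finiteVolume β p J (Λ n) 0, hΛ n⟩) atTop (𝓝 μ) ∧
        LongRangeSOS.IsGibbs β p J (μ : Measure LongRangeSOS.Config) ∧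
        LongRangeSOS.IsShiftInvariant (μ : Measure LongRangeSOS.Config) := by
  rintro ⟨Λ, -, -, ⟨C, hC⟩, hΛ, μ, hμ, hgibbs, hinv⟩
  have hle := lintegral_ofReal_le_of_tendsto hμ (f := fun φ => (φ 0 : ℝ) ^ 2) (by fun_prop)
    (fun φ => sq_nonneg _) fun n => (hC n).le
  exact (hle.trans_lt ENNReal.ofReal_lt_top).ne <| corollary2_general (by linarith) hp.2
    (summable_natCast_mul_of_isBigO_rpow hα hJ) hgibbs hinv
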